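/- Let $q$ be a prime power. For $n \ge 0$ let $E(q,n)$ be the set of all linear subspaces of $\mathrm{GF}(q)^n$, with the subspace metric $d_S(U,V) = \dim(U+V) - \dim(U\cap V)$. A subspace code is a nonempty subset $\mathcal{C} \subseteq E(q,n)$; its subspace covering radius is $\max_{U \in E(q,n)} \min_{V \in \mathcal{C}} d_S(U,V)$. For an integer $\rho \ge 0$ let $K_S(q,n,\rho)$ be the minimum cardinality of a subspace code in $E(q,n)$ whose subspace covering radius is at most $\rho$, and for real $\rho' \ge 0$ put $$k_S(\rho') = \liminf_{n\to\infty} \frac{\log_q K_S(q,n,\lfloor n\rho'\rfloor)}{\log_q |E(q,n)|}.$$ Then $k_S(\rho') = 1 - 2\rho'$ for $0 \le \rho' \le \tfrac12$, and $k_S(\rho') = 0$ for all $\rho' \ge \tfrac12$. -/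

import Mathlib

namespace SubspaceCode

/-- The projective space `E(q,n)`: the set of all linear subspaces of `GF(q)^n`, of every dimension,
where `F = GF(q)`. -/
abbrev ProjSpace (F : Type*) [Field F] (n : ℕ) : Type _ := Submodule F (Fin n → F)

/-- The subspace metric `dim (U + V) - dim (U ∩ V)`. (The subtraction of natural numbers does not
truncate, since `U ∩ V ⊆ U + V`.) -/
noncomputable def subspaceDist {F : Type*} [Field F] {n : ℕ} (U V : ProjSpace F n) : ℕ :=
  Module.finrank F ↥(U ⊔ V) - Module.finrank F ↥(U ⊓ V)

/-- The distance `min {d(U,V) : V ∈ C}` from a subspace to a (nonempty) code `C`. -/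
noncomputable def distToCode {F : Type*} [Field F] {n : ℕ}
    (U : ProjSpace F n) (C : Set (ProjSpace F n)) : ℕ :=
  ⨅ V : C, subspaceDist U (V : ProjSpace F n)

/-- The subspace covering radius `max {d(U,C) : U ∈ E(q,n)}` of a (nonempty) code `C`. All the
distances are at most `n`, so that the supremum is a maximum. -/
noncomputable def coveringRadius {F : Type*} [Field F] {n : ℕ} (C : Set (ProjSpace F n)) : ℕ :=
  ⨆ U : ProjSpace F n, distToCode U C

/-- `K_S(q,n,ρ)`: the minimum cardinality of a subspace code (a nonempty set of subspaces of
`GF(q)^n`) whose subspace covering radius is at most `ρ`. -/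
noncomputable def minCoveringCard (F : Type*) [Field F] (n ρ : ℕ) : ℕ :=
  sInf {m : ℕ | ∃ C : Set (ProjSpace F n), C.Nonempty ∧ coveringRadius C ≤ ρ ∧ C.ncard = m}

/-- The asymptotic rate of covering subspace codes,
`k_S(ρ') = liminf_n log_q K_S(q, n, ⌊n ρ'⌋) / log_q |E(q,n)|`, as an extended real number. -/
noncomputable def coveringRate (F : Type*) [Field F] (ρ' : ℝ) : EReal :=
  Filter.liminf
    (fun n : ℕ =>
      ((Real.logb (Nat.card F : ℝ) (minCoveringCard F n ⌊(n : ℝ) * ρ'⌋₊ : ℝ) /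
        Real.logb (Nat.card F : ℝ) (Nat.card (ProjSpace F n) : ℝ) : ℝ) : EReal))
    Filter.atTop

end SubspaceCode

/-! Up to factors `q^{O(n)}`, an `n`-space has `q^{k(n-k)}` subspaces of dimension `k`, so `log_q
|E(q,n)| = n²/4 + O(n)`. It remains to show `log_q K_S = n(n-2ρ)/4 + O(n)` for `2ρ ≤ n`. Upper bound
(`minCoveringCard_le_pow`): a space of dimension at least `n/2` is enlarged within distance `ρ` to
absorb a fixed `ρ`-space, and a smaller one is cut down into a fixed space of codimension `ρ`; few
spaces arise this way. Lower bound (`le_minCoveringCard_mul`): the middle layer alone has about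
`q^{n²/4}` spaces, and a ball meets it in at most `q^{nρ/2+O(n)}` of them (`ncard_ball_le`). For `ρ'
≥ 1/2` the code `{⊥, ⊤}` suffices. The quotients converge, so the liminf is a limit. -/

namespace SubspaceCode
open Module

/-! ### Subspace counts up to a factor `2^k` -/

section Counting

variable {F V : Type*} [Field F] [AddCommGroup V] [Module F V] [Finite V]

theorem exists_finrank_eq_between {A B : Submodule F V} (h : A ≤ B) {d : ℕ}
    (hA : finrank F A ≤ d) (hB : d ≤ finrank F B) :
    ∃ U, A ≤ U ∧ U ≤ B ∧ finrank F U = d := by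
  induction d, hA using Nat.le_induction with
  | base => exact ⟨A, le_rfl, h, rfl⟩
  | succ d _ ih =>
    obtain ⟨U, hAU, hUB, hU⟩ := ih (by omega)
    obtain ⟨x, hxB, hxU⟩ : ∃ x ∈ B, x ∉ U := by
      by_contra! hc
      have := Submodule.finrank_mono (R := F) (show B ≤ U from hc)
      omega
    refine ⟨U ⊔ Submodule.span F {x}, hAU.trans le_sup_left,
      sup_le hUB ((Submodule.span_singleton_le_iff_mem _ _).2 hxB), ?_⟩
    have hx : x ≠ 0 := fun h => hxU (h ▸ U.zero_mem)
    have h1 := Submodule.finrank_sup_add_finrank_inf_eq U (Submodule.span F {x})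
    have h2 : U ⊓ Submodule.span F {x} = ⊥ :=
      disjoint_iff.1 ((Submodule.disjoint_span_singleton' hx).2 hxU)
    rw [h2, finrank_bot, finrank_span_singleton hx] at h1
    omega

variable [Finite F]

theorem two_le_card_field (F : Type*) [Field F] [Finite F] : 2 ≤ Nat.card F :=
  Finite.one_lt_card

/-- A linearly independent tuple in `V` is the same as a subspace together with a basis of it. -/
theorem card_linearIndependent_eq_card_mul_prod {k : ℕ} (hk : k ≤ finrank F V) :
    ∏ i : Fin k, (Nat.card F ^ finrank F V - Nat.card F ^ i.val) =
      Nat.card {U : Submodule F V // finrank F U = k} *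
        ∏ i : Fin k, (Nat.card F ^ k - Nat.card F ^ i.val) := by
  have := Fintype.ofFinite F
  have := Fintype.ofFinite {U : Submodule F V // finrank F U = k}
  have hspan (U : Submodule F V) (hU : finrank F U = k) (s : Fin k → U)
      (hs : LinearIndependent F s) : Submodule.span F (Set.range fun i => (s i : V)) = U := by
    refine Submodule.eq_of_le_of_finrank_eq ?_ ?_
    · rw [Submodule.span_le]
      rintro _ ⟨i, rfl⟩
      exact (s i).2
    · have := hs.map' (Submodule.subtype U) (Submodule.ker_subtype _)
      exact (finrank_span_eq_card this).trans (by rw [Fintype.card_fin, hU])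
  let f : (Σ U : {U : Submodule F V // finrank F U = k},
      {s : Fin k → U.1 // LinearIndependent F s}) → {s : Fin k → V // LinearIndependent F s} :=
    fun p => ⟨fun i => (p.2.1 i : V),
      p.2.2.map' (Submodule.subtype _) (Submodule.ker_subtype _)⟩
  have hf : f.Bijective := by
    constructor
    · rintro ⟨⟨U, hU⟩, ⟨s, hs⟩⟩ ⟨⟨W, hW⟩, ⟨t, ht⟩⟩ h
      have h : (fun i => (s i : V)) = fun i => (t i : V) := congrArg Subtype.val h
      obtain rfl : U = W := by rw [← hspan U hU s hs, ← hspan W hW t ht, h]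
      obtain rfl : s = t := funext fun i => Subtype.ext (congrFun h i)
      rfl
    · rintro ⟨s, hs⟩
      exact ⟨⟨⟨Submodule.span F (Set.range s), by rw [finrank_span_eq_card hs, Fintype.card_fin]⟩,
        ⟨fun i => ⟨s i, Submodule.subset_span ⟨i, rfl⟩⟩,
          LinearIndependent.of_comp (Submodule.subtype _) hs⟩⟩, rfl⟩
  have h1 := card_linearIndependent (K := F) (V := V) hk
  rw [← Nat.card_congr (Equiv.ofBijective f hf), Nat.card_sigma] at h1
  rw [Nat.card_eq_fintype_card (α := F), ← h1, Finset.sum_congr rfl fun U _ => ?_,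
    Finset.sum_const, Finset.card_univ, smul_eq_mul, ← Nat.card_eq_fintype_card]
  rw [card_linearIndependent U.2.ge, U.2]

/-- Since `q ≥ 2`, each factor `q^k - q^i` with `i < k` is at least `q^k / 2`; this costs `2^k` in
all. -/
theorem card_subspaces_le (k : ℕ) :
    Nat.card {U : Submodule F V // finrank F U = k} ≤
      2 ^ k * Nat.card F ^ (k * (finrank F V - k)) := by
  have hq := two_le_card_field F
  set q := Nat.card F
  rcases lt_or_ge (finrank F V) k with hk | hk
  · have : IsEmpty {U : Submodule F V // finrank F U = k} :=
      ⟨fun U => by have := Submodule.finrank_le U.1; have := U.2; omega⟩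
    simp
  have h := card_linearIndependent_eq_card_mul_prod (F := F) hk
  set G := Nat.card {U : Submodule F V // finrank F U = k}
  have h1 : ∏ i : Fin k, (q ^ finrank F V - q ^ i.val) ≤ q ^ (finrank F V * k) := by
    calc _ ≤ ∏ _i : Fin k, q ^ finrank F V := Finset.prod_le_prod' fun i _ => Nat.sub_le _ _
      _ = _ := by simp [pow_mul]
  have h2 : q ^ (k * k) ≤ 2 ^ k * ∏ i : Fin k, (q ^ k - q ^ i.val) := by
    calc q ^ (k * k) = ∏ _i : Fin k, q ^ k := by simp [pow_mul]
      _ ≤ ∏ i : Fin k, 2 * (q ^ k - q ^ i.val) := by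
        refine Finset.prod_le_prod' fun i _ => ?_
        have : 2 * q ^ i.val ≤ q ^ k := calc
          2 * q ^ i.val ≤ q ^ (i.val + 1) := by rw [pow_succ']; gcongr
          _ ≤ q ^ k := Nat.pow_le_pow_right (by omega) i.2
        omega
      _ = _ := by simp [Finset.prod_mul_distrib]
  refine Nat.le_of_mul_le_mul_right (c := q ^ (k * k)) ?_ (by positivity)
  calc G * q ^ (k * k) ≤ G * (2 ^ k * ∏ i : Fin k, (q ^ k - q ^ i.val)) := by gcongr
    _ = 2 ^ k * ∏ i : Fin k, (q ^ finrank F V - q ^ i.val) := by rw [h]; ring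
    _ ≤ 2 ^ k * q ^ (finrank F V * k) := by gcongr
    _ = _ := by
      obtain ⟨d, hd⟩ := Nat.exists_eq_add_of_le hk
      rw [hd, Nat.add_sub_cancel_left]
      ring

theorem le_card_subspaces {k : ℕ} (hk : k ≤ finrank F V) :
    Nat.card F ^ (k * (finrank F V - k)) ≤
      Nat.card {U : Submodule F V // finrank F U = k} := by
  have hq := two_le_card_field F
  have h := card_linearIndependent_eq_card_mul_prod (F := F) hk
  set q := Nat.card F
  refine Nat.le_of_mul_le_mul_right (c := ∏ i : Fin k, (q ^ k - q ^ i.val)) ?_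
    (Finset.prod_pos fun i _ => Nat.sub_pos_of_lt (Nat.pow_lt_pow_right (by omega) i.2))
  rw [← h]
  calc _ = ∏ i : Fin k, q ^ (finrank F V - k) * (q ^ k - q ^ i.val) := by
        rw [Finset.prod_mul_distrib, Finset.prod_const, Finset.card_univ, Fintype.card_fin,
          ← pow_mul, mul_comm k]
    _ ≤ _ := by
      refine Finset.prod_le_prod' fun i _ => ?_
      rw [Nat.mul_sub, ← pow_add, ← pow_add, Nat.sub_add_cancel hk]
      exact Nat.sub_le_sub_left (Nat.pow_le_pow_right (by omega) (by omega)) _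

/-- Passing to `V ⧸ A` reduces this to `card_subspaces_le` in dimension `k - dim A`. -/
theorem card_subspaces_ge_submodule_le (A : Submodule F V) (k : ℕ) :
    {U : Submodule F V | A ≤ U ∧ finrank F U = k}.ncard ≤
      2 ^ k * Nat.card F ^ ((k - finrank F A) * (finrank F V - k)) := by
  have hA := A.finrank_quotient_add_finrank
  have : Finite (V ⧸ A) := Finite.of_surjective _ A.mkQ_surjective
  calc _ ≤ Nat.card {U : Submodule F (V ⧸ A) // finrank F U = k - finrank F A} := by
        refine Nat.card_le_card_of_injective (fun U => ⟨U.1.map A.mkQ, ?_⟩) ?_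
        · have h := (A.mkQ.domRestrict U.1).finrank_range_add_finrank_ker
          rw [LinearMap.range_domRestrict, LinearMap.ker_domRestrict, Submodule.ker_mkQ,
            U.2.2] at h
          have h2 := (Submodule.comapSubtypeEquivOfLe U.2.1).finrank_eq
          omega
        · intro U W h
          have h := congrArg (Submodule.comap A.mkQ) (congrArg Subtype.val h)
          simp only [Submodule.comap_map_mkQ, sup_eq_right.2 U.2.1, sup_eq_right.2 W.2.1] at h
          exact Subtype.ext h
    _ ≤ _ := card_subspaces_le _
    _ ≤ _ := by
      have := two_le_card_field F
      gcongr ?_ ^ ?_ * ?_ ^ (_ * ?_)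
      all_goals omega

theorem card_subspaces_le_submodule_le (B : Submodule F V) (k : ℕ) :
    {U : Submodule F V | U ≤ B ∧ finrank F U = k}.ncard ≤
      2 ^ k * Nat.card F ^ (k * (finrank F B - k)) := by
  calc _ ≤ Nat.card {U : Submodule F B // finrank F U = k} := by
        refine Nat.card_le_card_of_injective (fun U => ⟨U.1.comap B.subtype, ?_⟩) ?_
        · rw [(Submodule.comapSubtypeEquivOfLe U.2.1).finrank_eq, U.2.2]
        · intro U W h
          have h := congrArg (Submodule.map B.subtype) (congrArg Subtype.val h)
          simp only [Submodule.map_comap_subtype, inf_eq_right.2 U.2.1, inf_eq_right.2 W.2.1] at h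
          exact Subtype.ext h
    _ ≤ _ := card_subspaces_le _

end Counting

/-! ### Bounds for covering codes -/

section Covering

variable {F : Type*} [Field F] {n : ℕ}

theorem subspaceDist_of_le {U V : ProjSpace F n} (h : U ≤ V) :
    subspaceDist U V = finrank F V - finrank F U := by
  rw [subspaceDist, sup_eq_right.2 h, inf_eq_left.2 h]

theorem subspaceDist_of_ge {U V : ProjSpace F n} (h : V ≤ U) :
    subspaceDist U V = finrank F U - finrank F V := by
  rw [subspaceDist, sup_eq_left.2 h, inf_eq_right.2 h]

variable [Finite F]

theorem ncard_le_mul_ncard_of_fiber_le {α β : Type*} [Finite α] {S : Set α} {T : Set β}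
    (hT : T.Finite) (f : α → β) (hf : ∀ a ∈ S, f a ∈ T) (b : ℕ)
    (hb : ∀ t ∈ T, {a ∈ S | f a = t}.ncard ≤ b) : S.ncard ≤ b * T.ncard := by
  classical
  have hS : S.Finite := S.toFinite
  rw [Set.ncard_eq_toFinset_card S hS, Set.ncard_eq_toFinset_card T hT]
  refine Finset.card_le_mul_card_image_of_maps_to (f := f) (by simpa using hf) b fun t ht => ?_
  rw [← Set.ncard_coe_finset]
  simpa using hb t (by simpa using ht)

theorem ncard_le_mul_of_finrank_fiber_le (S : Set (ProjSpace F n)) (b : ℕ)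
    (hb : ∀ k ≤ n, {U ∈ S | finrank F U = k}.ncard ≤ b) : S.ncard ≤ b * (n + 1) := by
  have h := ncard_le_mul_ncard_of_fiber_le (S := S) (T := Set.Iic n) (Set.finite_Iic n)
    (fun U => finrank F U) (fun U _ => by simpa using Submodule.finrank_le U) b hb
  simpa using h

/-- Nonemptiness matters: an infimum over an empty code would be `0`. -/
theorem coveringRadius_le_iff {C : Set (ProjSpace F n)} (hC : C.Nonempty) {ρ : ℕ} :
    coveringRadius C ≤ ρ ↔ ∀ U, ∃ V ∈ C, subspaceDist U V ≤ ρ := by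
  have := hC.to_subtype
  have hd (U : ProjSpace F n) : distToCode U C ≤ ρ ↔ ∃ V ∈ C, subspaceDist U V ≤ ρ := by
    constructor
    · intro h
      obtain ⟨V, hV⟩ := ciInf_mem fun V : C => subspaceDist U (V : ProjSpace F n)
      exact ⟨V, V.2, hV.trans_le h⟩
    · rintro ⟨V, hV, h⟩
      exact (ciInf_le (OrderBot.bddBelow _) (⟨V, hV⟩ : C)).trans h
  simp only [← hd]
  exact ⟨fun h U => (le_ciSup (Set.finite_range _).bddAbove U).trans h, fun h => ciSup_le h⟩

theorem minCoveringCard_le {C : Set (ProjSpace F n)} (hC : C.Nonempty) {ρ : ℕ}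
    (h : ∀ U, ∃ V ∈ C, subspaceDist U V ≤ ρ) : minCoveringCard F n ρ ≤ C.ncard :=
  Nat.sInf_le ⟨C, hC, (coveringRadius_le_iff hC).2 h, rfl⟩

theorem exists_code_ncard_eq_minCoveringCard (F : Type*) [Field F] [Finite F] (n ρ : ℕ) :
    ∃ C : Set (ProjSpace F n), C.Nonempty ∧ (∀ U, ∃ V ∈ C, subspaceDist U V ≤ ρ) ∧
      C.ncard = minCoveringCard F n ρ := by
  have hne : {m : ℕ | ∃ C : Set (ProjSpace F n),
      C.Nonempty ∧ coveringRadius C ≤ ρ ∧ C.ncard = m}.Nonempty :=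
    ⟨_, Set.univ, Set.univ_nonempty, (coveringRadius_le_iff Set.univ_nonempty).2 fun U =>
      ⟨U, trivial, by rw [subspaceDist_of_le le_rfl, Nat.sub_self]; exact Nat.zero_le _⟩, rfl⟩
  obtain ⟨C, hC, h, hc⟩ := Nat.sInf_mem hne
  exact ⟨C, hC, (coveringRadius_le_iff hC).1 h, hc⟩

theorem minCoveringCard_pos (F : Type*) [Field F] [Finite F] (n ρ : ℕ) :
    0 < minCoveringCard F n ρ := by
  obtain ⟨C, hC, -, h⟩ := exists_code_ncard_eq_minCoveringCard F n ρ
  exact h ▸ (Set.ncard_pos).2 hC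

/-- The two trivial subspaces cover everything within distance `n / 2`. -/
theorem minCoveringCard_le_two {ρ : ℕ} (h : n / 2 ≤ ρ) : minCoveringCard F n ρ ≤ 2 := by
  refine (minCoveringCard_le (C := {⊥, ⊤}) (by simp) fun U => ?_).trans
    ((Set.ncard_insert_le _ _).trans (by rw [Set.ncard_singleton]))
  rcases le_or_gt (finrank F U) (n / 2) with hU | hU
  · refine ⟨⊥, by simp, ?_⟩
    rw [subspaceDist_of_ge bot_le]
    omega
  · refine ⟨⊤, by simp, ?_⟩
    rw [subspaceDist_of_le le_top, finrank_top, finrank_fin_fun]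
    omega

theorem succ_le_card_field_pow (F : Type*) [Field F] [Finite F] (n : ℕ) :
    n + 1 ≤ Nat.card F ^ n :=
  Nat.lt_pow_self (two_le_card_field F)

theorem two_pow_le_card_field_pow (F : Type*) [Field F] [Finite F] {k n : ℕ} (h : k ≤ n) :
    2 ^ k ≤ Nat.card F ^ n :=
  (Nat.pow_le_pow_right two_pos h).trans (Nat.pow_le_pow_left (two_le_card_field F) n)

theorem card_projSpace_le (F : Type*) [Field F] [Finite F] (n : ℕ) :
    Nat.card (ProjSpace F n) ≤ Nat.card F ^ (2 * n + n * n / 4) := by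
  have hq := two_le_card_field F
  rw [← Set.ncard_univ]
  refine (ncard_le_mul_of_finrank_fiber_le _ (Nat.card F ^ (n + n * n / 4)) fun k hk => ?_).trans ?_
  · have h := card_subspaces_le (F := F) (V := Fin n → F) k
    rw [finrank_fin_fun] at h
    calc _ = Nat.card {U : ProjSpace F n // finrank F U = k} := by
          simp only [Set.mem_univ, true_and]; rfl
      _ ≤ _ := h
      _ ≤ Nat.card F ^ n * Nat.card F ^ (n * n / 4) := by
        refine Nat.mul_le_mul (two_pow_le_card_field_pow F hk)
          (Nat.pow_le_pow_right (by omega) ?_)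
        · rw [Nat.le_div_iff_mul_le (by omega)]
          obtain ⟨d, rfl⟩ := Nat.exists_eq_add_of_le hk
          rw [Nat.add_sub_cancel_left]
          zify
          nlinarith [sq_nonneg ((k : ℤ) - d)]
      _ = _ := (pow_add _ _ _).symm
  · calc _ ≤ Nat.card F ^ (n + n * n / 4) * Nat.card F ^ n := by
          gcongr; exact succ_le_card_field_pow F n
      _ = _ := by rw [← pow_add]; ring_nf

theorem le_card_projSpace (F : Type*) [Field F] [Finite F] {m n : ℕ} (h : m ≤ n) :
    Nat.card F ^ (m * (n - m)) ≤ Nat.card (ProjSpace F n) := by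
  have h1 := le_card_subspaces (F := F) (V := Fin n → F) (k := m) (by simpa using h)
  rw [finrank_fin_fun] at h1
  exact h1.trans (Nat.card_le_card_of_injective _ Subtype.val_injective)

/-- Spaces that contain a fixed `ρ`-dimensional space, or lie in a fixed space of codimension `ρ`,
cover everything once their dimensions are at least `n / 2 + ρ`, or at most `n / 2 - ρ`. -/
theorem minCoveringCard_le_pow {ρ : ℕ} (h : 2 * ρ ≤ n) :
    minCoveringCard F n ρ ≤ Nat.card F ^ (1 + 2 * n + n * (n - 2 * ρ) / 4) := by
  have hq := two_le_card_field F
  have htop : finrank F (⊤ : ProjSpace F n) = n := by rw [finrank_top, finrank_fin_fun]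
  obtain ⟨W, -, -, hW⟩ := exists_finrank_eq_between (F := F) (V := Fin n → F) (A := ⊥) (B := ⊤)
    bot_le (d := ρ) (by simp) (by omega)
  obtain ⟨H, -, -, hH⟩ := exists_finrank_eq_between (F := F) (V := Fin n → F) (A := ⊥) (B := ⊤)
    bot_le (d := n - ρ) (by simp) (by omega)
  obtain ⟨e, he⟩ := Nat.exists_eq_add_of_le h
  set C₁ : Set (ProjSpace F n) := {V | W ≤ V ∧ n + 2 * ρ ≤ 2 * finrank F V}
  set C₂ : Set (ProjSpace F n) := {V | V ≤ H ∧ 2 * finrank F V + 2 * ρ ≤ n}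
  set b := Nat.card F ^ n * Nat.card F ^ (n * (n - 2 * ρ) / 4)
  have h₁ : C₁.ncard ≤ b * (n + 1) := by
    refine ncard_le_mul_of_finrank_fiber_le _ _ fun k hk => ?_
    rcases lt_or_ge (2 * k) (n + 2 * ρ) with hk' | hk'
    · refine ((Set.ncard_eq_zero (Set.toFinite _)).2
        (Set.eq_empty_of_forall_notMem ?_)).trans_le (Nat.zero_le _)
      rintro U ⟨⟨-, h1⟩, h2⟩
      omega
    refine (Set.ncard_le_ncard (t := {U | W ≤ U ∧ finrank F U = k}) ?_).trans
      ((card_subspaces_ge_submodule_le W k).trans ?_)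
    · exact fun U hU => ⟨hU.1.1, hU.2⟩
    rw [hW, finrank_fin_fun]
    refine Nat.mul_le_mul (two_pow_le_card_field_pow F hk) (Nat.pow_le_pow_right (by omega) ?_)
    rw [Nat.le_div_iff_mul_le (by omega)]
    obtain ⟨x, rfl⟩ := Nat.exists_eq_add_of_le (show ρ ≤ k by omega)
    obtain ⟨y, hy⟩ := Nat.exists_eq_add_of_le hk
    rw [show n - (ρ + x) = y by omega, show ρ + x - ρ = x by omega,
      show n - 2 * ρ = e by omega]
    -- With `t = 2x - n = e - 2y ≥ 0`, one has `4xy = (n + t)(e - t) ≤ ne` because `e ≤ n`.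
    have hx : n ≤ 2 * x := by omega
    have h3 : 2 * y ≤ e := by omega
    have h4 : n + e = 2 * x + 2 * y := by omega
    zify at *
    nlinarith
  have h₂ : C₂.ncard ≤ b * (n + 1) := by
    refine ncard_le_mul_of_finrank_fiber_le _ _ fun k hk => ?_
    rcases lt_or_ge n (2 * k + 2 * ρ) with hk' | hk'
    · refine ((Set.ncard_eq_zero (Set.toFinite _)).2
        (Set.eq_empty_of_forall_notMem ?_)).trans_le (Nat.zero_le _)
      rintro U ⟨⟨-, h1⟩, h2⟩
      omega
    refine (Set.ncard_le_ncard (t := {U | U ≤ H ∧ finrank F U = k}) ?_).trans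
      ((card_subspaces_le_submodule_le H k).trans ?_)
    · exact fun U hU => ⟨hU.1.1, hU.2⟩
    rw [hH]
    refine Nat.mul_le_mul (two_pow_le_card_field_pow F hk) (Nat.pow_le_pow_right (by omega) ?_)
    rw [Nat.le_div_iff_mul_le (by omega)]
    obtain ⟨y, hy⟩ := Nat.exists_eq_add_of_le (show k ≤ n - ρ by omega)
    rw [show n - ρ - k = y by omega, show n - 2 * ρ = e by omega]
    have hx : n ≤ 2 * y := by omega
    have h3 : 2 * k ≤ e := by omega
    have h4 : n + e = 2 * k + 2 * y := by omega
    zify at *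
    nlinarith
  have hC : minCoveringCard F n ρ ≤ (C₁ ∪ C₂).ncard := by
    refine minCoveringCard_le ⟨⊥, Or.inr ⟨bot_le, by rw [finrank_bot]; omega⟩⟩ fun U => ?_
    rcases le_total n (2 * finrank F U) with hU | hU
    · rcases le_total (finrank F U + ρ) n with hU' | hU'
      · have hs := Submodule.finrank_sup_add_finrank_inf_eq U W
        obtain ⟨V, hV, -, hVd⟩ := exists_finrank_eq_between (F := F) (A := U ⊔ W) (B := ⊤) le_top
          (d := finrank F U + ρ) (by omega) (by omega)
        refine ⟨V, Or.inl ⟨le_sup_right.trans hV, by omega⟩, ?_⟩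
        rw [subspaceDist_of_le (le_sup_left.trans hV)]
        omega
      · refine ⟨⊤, Or.inl ⟨le_top, by omega⟩, ?_⟩
        rw [subspaceDist_of_le le_top]
        omega
    · rcases le_total ρ (finrank F U) with hU' | hU'
      · have hs := Submodule.finrank_sup_add_finrank_inf_eq U H
        have hs' := Submodule.finrank_le (U ⊔ H)
        rw [finrank_fin_fun] at hs'
        obtain ⟨V, -, hV, hVd⟩ := exists_finrank_eq_between (F := F) (A := ⊥) (B := U ⊓ H) bot_le
          (d := finrank F U - ρ) (by simp) (by omega)
        refine ⟨V, Or.inr ⟨hV.trans inf_le_right, by omega⟩, ?_⟩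
        rw [subspaceDist_of_ge (hV.trans inf_le_left)]
        omega
      · refine ⟨⊥, Or.inr ⟨bot_le, by rw [finrank_bot]; omega⟩, ?_⟩
        rw [subspaceDist_of_ge bot_le]
        omega
  calc minCoveringCard F n ρ ≤ 2 * (b * (n + 1)) := by
        have := Set.ncard_union_le C₁ C₂
        omega
    _ ≤ Nat.card F * (b * Nat.card F ^ n) := by
        gcongr; exact succ_le_card_field_pow F n
    _ = _ := by rw [pow_add, pow_add, pow_one, two_mul n, pow_add]; ring

/-- A ball of radius `ρ` contains few spaces of a given dimension. -/
theorem ncard_ball_le {m ρ : ℕ} (hm : 2 * m ≤ n) (V : ProjSpace F n) :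
    {U : ProjSpace F n | finrank F U = m ∧ subspaceDist U V ≤ ρ}.ncard ≤
      Nat.card F ^ (3 * n + (n - m) * ρ) := by
  have hq := two_le_card_field F
  set S := {U : ProjSpace F n | finrank F U = m ∧ subspaceDist U V ≤ ρ}
  have h := ncard_le_mul_ncard_of_fiber_le (S := S) (T := Set.Iic n) (Set.finite_Iic n)
    (fun U => finrank F (U ⊓ V : ProjSpace F n))
    (fun U _ => by simpa using Submodule.finrank_le (U ⊓ V))
    (Nat.card F ^ (2 * n + (n - m) * ρ)) fun i hi => ?_
  · calc _ ≤ _ := h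
      _ = Nat.card F ^ (2 * n + (n - m) * ρ) * (n + 1) := by simp
      _ ≤ Nat.card F ^ (2 * n + (n - m) * ρ) * Nat.card F ^ n := by
        gcongr; exact succ_le_card_field_pow F n
      _ = _ := by rw [← pow_add]; ring_nf
  -- A member of the fibre forces `(m - i) + (dim V - i) ≤ ρ`, the left side being its distance to
  -- `V`.
  rcases Set.eq_empty_or_nonempty
    {U ∈ S | finrank F (U ⊓ V : ProjSpace F n) = i} with h0 | ⟨U₀, ⟨hU₀, hd⟩, hi₀⟩
  · rw [h0, Set.ncard_empty]
    exact Nat.zero_le _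
  have hs := Submodule.finrank_sup_add_finrank_inf_eq U₀ V
  have him := Submodule.finrank_mono (R := F) (inf_le_left : U₀ ⊓ V ≤ U₀)
  have hiv := Submodule.finrank_mono (R := F) (inf_le_right : U₀ ⊓ V ≤ V)
  rw [subspaceDist] at hd
  -- Choose `I = U ⊓ V` inside `V`, then `U` above `I`.
  have h2 := ncard_le_mul_ncard_of_fiber_le
    (S := {U ∈ S | finrank F (U ⊓ V : ProjSpace F n) = i})
    (T := {I : ProjSpace F n | I ≤ V ∧ finrank F I = i}) (Set.toFinite _)
    (fun U => U ⊓ V) (fun U hU => ⟨inf_le_right, hU.2⟩)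
    (2 ^ m * Nat.card F ^ ((m - i) * (n - m))) fun I hI => ?_
  · calc _ ≤ _ := h2
      _ ≤ (2 ^ m * Nat.card F ^ ((m - i) * (n - m))) *
          (2 ^ i * Nat.card F ^ (i * (finrank F V - i))) := by
        gcongr; exact card_subspaces_le_submodule_le V i
      _ ≤ (Nat.card F ^ n * Nat.card F ^ ((m - i) * (n - m))) *
          (Nat.card F ^ n * Nat.card F ^ (i * (finrank F V - i))) := by
        exact Nat.mul_le_mul (Nat.mul_le_mul_right _ (two_pow_le_card_field_pow F (by omega)))
          (Nat.mul_le_mul_right _ (two_pow_le_card_field_pow F hi))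
      _ = Nat.card F ^ (2 * n + ((m - i) * (n - m) + i * (finrank F V - i))) := by
        simp only [pow_add, two_mul]; ring
      _ ≤ _ := by
        refine Nat.pow_le_pow_right (by omega) (Nat.add_le_add_left ?_ _)
        -- Here `2m ≤ n` enters: `i ≤ m ≤ n - m`.
        calc _ ≤ (m - i) * (n - m) + (n - m) * (finrank F V - i) := by
              gcongr; omega
          _ = (n - m) * ((m - i) + (finrank F V - i)) := by ring
          _ ≤ _ := Nat.mul_le_mul_left _ (by omega)
  · refine (Set.ncard_le_ncard (t := {U | I ≤ U ∧ finrank F U = m}) ?_).trans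
      ((card_subspaces_ge_submodule_le I m).trans ?_)
    · rintro U ⟨⟨⟨hU, -⟩, -⟩, rfl⟩
      exact ⟨inf_le_left, hU⟩
    · rw [hI.2, finrank_fin_fun]

/-- Sphere-covering argument restricted to one layer: the balls around the codewords must cover all
`m`-spaces. -/
theorem le_minCoveringCard_mul {m : ℕ} (hm : 2 * m ≤ n) (ρ : ℕ) :
    Nat.card F ^ (m * (n - m)) ≤
      minCoveringCard F n ρ * Nat.card F ^ (3 * n + (n - m) * ρ) := by
  obtain ⟨C, -, hC, hcard⟩ := exists_code_ncard_eq_minCoveringCard F n ρ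
  choose f hfC hf using hC
  have h1 := le_card_subspaces (F := F) (V := Fin n → F) (k := m) (by simp; omega)
  rw [finrank_fin_fun] at h1
  have h2 := ncard_le_mul_ncard_of_fiber_le (S := {U : ProjSpace F n | finrank F U = m}) (T := C)
    C.toFinite f (fun U _ => hfC U) _ fun V _ =>
      (Set.ncard_le_ncard (t := {U : ProjSpace F n | finrank F U = m ∧ subspaceDist U V ≤ ρ}) (by
        rintro U ⟨hU, rfl⟩
        exact ⟨hU, hf U⟩)).trans (ncard_ball_le hm V)
  rw [hcard, mul_comm] at h2
  exact h1.trans h2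

end Covering

/-! ### Passage to the limit -/

section Asymptotics

open Filter Topology

/-- The constant `5` is a common slack that absorbs every linear error below, including those from
rounding. -/
theorem tendsto_div_sq_of_abs_sub_le {u : ℕ → ℝ} {c : ℝ}
    (h : ∀ n : ℕ, 1 ≤ n → |u n - c * (n : ℝ) ^ 2| ≤ 5 * (n : ℝ)) :
    Tendsto (fun n : ℕ => u n / (n : ℝ) ^ 2) atTop (𝓝 c) := by
  rw [tendsto_iff_norm_sub_tendsto_zero]
  refine squeeze_zero' (.of_forall fun _ => norm_nonneg _) ?_
    (tendsto_const_div_atTop_nhds_zero_nat (5 : ℝ))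
  filter_upwards [eventually_ge_atTop 1] with n hn
  have hn' : (0 : ℝ) < n := by exact_mod_cast hn
  rw [show u n / (n : ℝ) ^ 2 - c = (u n - c * (n : ℝ) ^ 2) / (n : ℝ) ^ 2 by field_simp,
    Real.norm_eq_abs, abs_div, abs_of_pos (pow_pos hn' 2), div_le_div_iff₀ (by positivity) hn']
  calc _ ≤ 5 * (n : ℝ) * n := by gcongr; exact h n hn
    _ = _ := by ring

variable (F : Type*) [Field F] [Finite F]

theorem logb_card_field_le {a e : ℕ} (ha : 0 < a) (h : a ≤ Nat.card F ^ e) :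
    Real.logb (Nat.card F) a ≤ e := by
  have hq : (1 : ℝ) < Nat.card F := by exact_mod_cast two_le_card_field F
  rw [Real.logb_le_iff_le_rpow hq (by exact_mod_cast ha), Real.rpow_natCast]
  exact_mod_cast h

theorem le_logb_card_field_add {a d e : ℕ} (ha : 0 < a)
    (h : Nat.card F ^ d ≤ a * Nat.card F ^ e) : (d : ℝ) ≤ Real.logb (Nat.card F) a + e := by
  have hq : (1 : ℝ) < Nat.card F := by exact_mod_cast two_le_card_field F
  have hq0 : (0 : ℝ) < Nat.card F := one_pos.trans hq
  have ha' : (0 : ℝ) < a := by exact_mod_cast ha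
  rw [← sub_le_iff_le_add, Real.le_logb_iff_rpow_le hq ha', Real.rpow_sub hq0,
    Real.rpow_natCast, Real.rpow_natCast, div_le_iff₀ (by positivity)]
  exact_mod_cast h

theorem half_mul_sub_half_ge (n : ℕ) :
    (n : ℝ) ^ 2 / 4 - 1 / 4 ≤ ((n / 2 * (n - n / 2) : ℕ) : ℝ) := by
  rcases Nat.even_or_odd' n with ⟨k, rfl | rfl⟩
  · rw [show 2 * k / 2 = k by omega, show 2 * k - k = k by omega]
    push_cast
    linarith
  · rw [show (2 * k + 1) / 2 = k by omega, show 2 * k + 1 - k = k + 1 by omega]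
    push_cast
    linarith

theorem abs_logb_card_projSpace_sub_le {n : ℕ} (hn : 1 ≤ n) :
    |Real.logb (Nat.card F) (Nat.card (ProjSpace F n)) - 1 / 4 * (n : ℝ) ^ 2| ≤ 5 * (n : ℝ) := by
  have hn' : (1 : ℝ) ≤ n := by exact_mod_cast hn
  have h1 := logb_card_field_le F Nat.card_pos (card_projSpace_le F n)
  have h2 := le_logb_card_field_add F (a := Nat.card (ProjSpace F n)) (e := 0) Nat.card_pos
    ((le_card_projSpace F (Nat.div_le_self n 2)).trans_eq (by simp))
  have h3 := half_mul_sub_half_ge n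
  have h4 : ((n * n / 4 : ℕ) : ℝ) ≤ ((n * n : ℕ) : ℝ) / 4 := Nat.cast_div_le
  push_cast at h1 h2 h3 h4
  rw [abs_le]
  constructor <;> nlinarith

theorem abs_logb_minCoveringCard_sub_le {ρ' : ℝ} (h0 : 0 ≤ ρ') (h1 : ρ' ≤ 1 / 2) {n : ℕ}
    (hn : 1 ≤ n) :
    |Real.logb (Nat.card F) (minCoveringCard F n ⌊(n : ℝ) * ρ'⌋₊) -
      (1 - 2 * ρ') / 4 * (n : ℝ) ^ 2| ≤ 5 * (n : ℝ) := by
  have hn' : (1 : ℝ) ≤ n := by exact_mod_cast hn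
  set ρ := ⌊(n : ℝ) * ρ'⌋₊
  have hρ1 : (ρ : ℝ) ≤ n * ρ' := Nat.floor_le (by positivity)
  have hρ2 : n * ρ' < (ρ : ℝ) + 1 := Nat.lt_floor_add_one _
  have hρ3 : (2 * ρ : ℝ) ≤ n := by nlinarith
  have hρ : 2 * ρ ≤ n := by exact_mod_cast hρ3
  have hup := logb_card_field_le F (minCoveringCard_pos F n ρ) (minCoveringCard_le_pow hρ)
  have hlo := le_logb_card_field_add F (minCoveringCard_pos F n ρ)
    (le_minCoveringCard_mul (m := n / 2) (by omega) ρ)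
  have h3 := half_mul_sub_half_ge n
  have h4 : ((n * (n - 2 * ρ) / 4 : ℕ) : ℝ) ≤ ((n * (n - 2 * ρ) : ℕ) : ℝ) / 4 := Nat.cast_div_le
  have h5 : ((n - n / 2 : ℕ) : ℝ) ≤ ((n + 1 : ℕ) : ℝ) / 2 := by
    rw [le_div_iff₀ two_pos]
    exact_mod_cast (by omega : (n - n / 2) * 2 ≤ n + 1)
  have h6 : ((n - n / 2 : ℕ) : ℝ) * ρ ≤ ((n + 1 : ℕ) : ℝ) / 2 * (n * ρ') := by gcongr
  rw [Nat.cast_mul n, Nat.cast_sub hρ] at h4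
  rw [Nat.cast_add, Nat.cast_mul _ ρ] at hlo
  push_cast at hup hlo h3 h4 h6
  rw [abs_le]
  constructor
  · nlinarith
  · nlinarith

end Asymptotics

end SubspaceCode

open Filter SubspaceCode in
theorem mainTheorem5 (F : Type*) [Field F] [Finite F] :
    (∀ ρ' : ℝ, 0 ≤ ρ' → ρ' ≤ 1 / 2 →
      SubspaceCode.coveringRate F ρ' = ((1 - 2 * ρ' : ℝ) : EReal)) ∧
    (∀ ρ' : ℝ, 1 / 2 ≤ ρ' → SubspaceCode.coveringRate F ρ' = 0) := by
  have hA := tendsto_div_sq_of_abs_sub_le fun n hn => abs_logb_card_projSpace_sub_le F (n := n) hn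
  -- Both logarithms are divided by `n²`, with limits `c/4` and `1/4`; the range `ρ' ≥ 1/2` is the
  -- case `c = 0`.
  have key {c ρ' : ℝ} (h : ∀ n : ℕ, 1 ≤ n → |Real.logb (Nat.card F)
      (minCoveringCard F n ⌊(n : ℝ) * ρ'⌋₊) - c / 4 * (n : ℝ) ^ 2| ≤ 5 * (n : ℝ)) :
      coveringRate F ρ' = (c : EReal) := by
    refine Tendsto.liminf_eq (EReal.tendsto_coe.2 ?_)
    have hK := (tendsto_div_sq_of_abs_sub_le h).div hA (by norm_num)
    rw [show c / 4 / (1 / 4) = c by ring] at hK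
    refine hK.congr' ?_
    filter_upwards [eventually_ge_atTop 1] with n hn
    have hn' : ((n : ℝ) ^ 2) ≠ 0 := by positivity
    exact div_div_div_cancel_right₀ hn' _ _
  refine ⟨fun ρ' h0 h1 => key fun n hn => abs_logb_minCoveringCard_sub_le F h0 h1 hn,
    fun ρ' h => ?_⟩
  rw [← EReal.coe_zero]
  refine key fun n hn => ?_
  have hn' : (1 : ℝ) ≤ n := by exact_mod_cast hn
  have hq : (1 : ℝ) < Nat.card F := by exact_mod_cast two_le_card_field F
  have hρ : n / 2 ≤ ⌊(n : ℝ) * ρ'⌋₊ := by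
    refine Nat.le_floor ((Nat.cast_div_le (m := n) (n := 2)).trans ?_)
    push_cast
    nlinarith
  have hpos := minCoveringCard_pos F n ⌊(n : ℝ) * ρ'⌋₊
  have h1 := logb_card_field_le F (e := 1) hpos
    ((minCoveringCard_le_two hρ).trans (by simpa using two_le_card_field F))
  have h2 := Real.logb_nonneg hq (Nat.one_le_cast (α := ℝ).2 hpos)
  push_cast at h1
  rw [zero_div, zero_mul, sub_zero, abs_of_nonneg h2]
  linarith
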